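/- **Theorem 3.1.** Let $(M,g_2)$ be a Riemannian manifold with Levi-Civita connection $\nabla^M$ and a Kenmotsu structure $(\psi,\xi,\eta)$, i.e. a smooth $(1,1)$-tensor field $\psi$, vector field $\xi$ and $1$-form $\eta$ with $\psi^2=-I+\eta\otimes\xi$, $\psi\xi=0$, $\eta\circ\psi=0$, $\eta(\xi)=1$, $g_2(\psi X,\psi Y)=g_2(X,Y)-\eta(X)\eta(Y)$, $g_2(\psi X,Y)=-g_2(X,\psi Y)$, $\eta(X)=g_2(X,\xi)$, $(\nabla^M_X\psi)Y=g_2(\psi X,Y)\xi-\eta(Y)\psi X$ and $\nabla^M_X\xi=X-\eta(X)\xi$. Let $(\overline M,g_1)$ be a Riemannian manifold with Levi-Civita connection $\nabla$, and let $F:\overline M\to M$ be a smooth Riemannian map, i.e. $g_2(F_*X,F_*Y)=g_1(X,Y)$ for all $X,Y$ in the horizontal bundle $(\ker F_*)^\perp$. Assume that $\xi\in\Gamma(\mathrm{range}\,F_*)$ and that $F$ is bi-slant: there is an orthogonal decomposition $\mathrm{range}\,F_*=D_{\theta_1}\oplus D_{\theta_2}\oplus\mathbb R\xi$ into smooth distributions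 along $F$ with $\psi D_{\theta_i}\perp D_{\theta_j}$ for $i\ne j$, such that for $i=1,2$ the angle between $\psi v$ and the subspace $D_{\theta_i}$ equals a constant $\theta_i\in[0,\pi/2]$ for all nonzero $v\in D_{\theta_i}$. Notation: $\nabla^F$ is the pullback of $\nabla^M$ along $F$; $(\nabla F_*)(X,Y)=\nabla^F_XF_*Y-F_*(\nabla_XY)$; ${}^*F_*$ is the pointwise adjoint of $F_*$; for a section $V$ of $(\mathrm{range}\,F_*)^\perp$ one writes $\nabla^F_XV=-S_VF_*X+\nabla^{F\perp}_XV$, with $-S_VF_*X$ in $\mathrm{range}\,F_*$ and $\nabla^{F\perp}_XV$ in $(\mathrm{range}\,F_*)^\perp$; for $W\in\mathrm{range}\,F_*$, $PW$ and $QW$ are the components of $\psi W$ in $\mathrm{range}\,F_*$ and in $(\mathrm{range}\,F_*)^\perp$; for $V\in(\mathrm{range}\,F_*)^\perp$, $\omega V$ is the component of $\psi V$ in $(\mathrm{range}\,F_*)^\perp$. Then $\mathrm{range}\,F_*$ defines a totally geodesic foliation, i.e. $\nabla^F_XF_*Y\in\Gamma(\mathrm{range}\,F_*)$ for all $X,Y\in\Gamma((\ker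 F_*)^\perp)$, if and only if $$Q\big(S_{QF_*Y}F_*X-F_*(\nabla_X{}^*F_*PF_*Y)\big)=\omega\big((\nabla F_*)(X,{}^*F_*PF_*Y)+\nabla^{F\perp}_XQF_*Y\big)$$ for all $X,Y\in\Gamma((\ker F_*)^\perp)$. -/

import Mathlib

open Bundle
open scoped Manifold ContDiff Topology InnerProductSpace

set_option linter.unusedSectionVars false

noncomputable section

namespace RiemGeom
variable {E : Type*} [NormedAddCommGroup E] [NormedSpace ℝ E] [FiniteDimensional ℝ E]
  {M : Type*} [TopologicalSpace M] [ChartedSpace E M] [IsManifold 𝓘(ℝ, E) ∞ M]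
  [RiemannianBundle (fun x : M ↦ TangentSpace 𝓘(ℝ, E) x)]
  [IsContMDiffRiemannianBundle 𝓘(ℝ, E) ∞ E (fun x : M ↦ TangentSpace 𝓘(ℝ, E) x)]

/-- Right-hand side of the Koszul formula: `g(∇_X Y, Z)` for the Levi-Civita connection. -/
def koszul (Y X Z : Π x : M, TangentSpace 𝓘(ℝ, E) x) (x : M) : ℝ :=
  (1 / 2 : ℝ) *
    (mvfderiv 𝓘(ℝ, E) (fun y : M ↦ ⟪Y y, Z y⟫_ℝ) x (X x)
      + mvfderiv 𝓘(ℝ, E) (fun y : M ↦ ⟪Z y, X y⟫_ℝ) x (Y x)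
      - mvfderiv 𝓘(ℝ, E) (fun y : M ↦ ⟪X y, Y y⟫_ℝ) x (Z x)
      + ⟪VectorField.mlieBracket 𝓘(ℝ, E) X Y x, Z x⟫_ℝ
      - ⟪VectorField.mlieBracket 𝓘(ℝ, E) X Z x, Y x⟫_ℝ
      - ⟪VectorField.mlieBracket 𝓘(ℝ, E) Y Z x, X x⟫_ℝ)

variable {x : M} {X Y Z : Π x : M, TangentSpace 𝓘(ℝ, E) x}

theorem mdiffAt_inner (hX : MDiffAt (T% X) x) (hY : MDiffAt (T% Y) x) :
    MDiffAt (fun y ↦ ⟪X y, Y y⟫_ℝ) x :=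
  MDifferentiableAt.inner_bundle (IB := 𝓘(ℝ, E)) (F := E)
    (E := fun x : M ↦ TangentSpace 𝓘(ℝ, E) x) (b := fun y ↦ y) hX hY

theorem koszul_tensorial_left (hY : MDiffAt (T% Y) x) (hZ : MDiffAt (T% Z) x) :
    TensorialAt 𝓘(ℝ, E) E (fun X ↦ koszul Y X Z x) x where
  smul {f X} hf hX := by
    have := FiniteDimensional.complete ℝ E
    simp only [koszul, VectorField.mlieBracket_smul_left hf hX, Pi.smul_apply',
      real_inner_smul_left, real_inner_smul_right, inner_add_left,
      mvfderiv_fun_mul hf (mdiffAt_inner hZ hX), mvfderiv_fun_mul hf (mdiffAt_inner hX hY)]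
    simp
    rw [real_inner_comm (X x) (Z x)]
    ring
  add {X X'} hX hX' := by
    have := FiniteDimensional.complete ℝ E
    simp only [koszul, VectorField.mlieBracket_add_left hX hX', Pi.add_apply,
      inner_add_left, inner_add_right,
      mvfderiv_fun_add (mdiffAt_inner hZ hX) (mdiffAt_inner hZ hX'),
      mvfderiv_fun_add (mdiffAt_inner hX hY) (mdiffAt_inner hX' hY)]
    simp
    ring

theorem koszul_tensorial_right (hY : MDiffAt (T% Y) x) (hX : MDiffAt (T% X) x) :
    TensorialAt 𝓘(ℝ, E) E (fun Z ↦ koszul Y X Z x) x where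
  smul {f Z} hf hZ := by
    have := FiniteDimensional.complete ℝ E
    simp only [koszul, VectorField.mlieBracket_smul_right hf hZ, Pi.smul_apply',
      real_inner_smul_left, real_inner_smul_right, inner_add_left,
      mvfderiv_fun_mul hf (mdiffAt_inner hZ hX), mvfderiv_fun_mul hf (mdiffAt_inner hY hZ)]
    simp
    rw [real_inner_comm (Z x) (Y x)]
    ring
  add {Z Z'} hZ hZ' := by
    have := FiniteDimensional.complete ℝ E
    simp only [koszul, VectorField.mlieBracket_add_right hZ hZ', Pi.add_apply,
      inner_add_left, inner_add_right,
      mvfderiv_fun_add (mdiffAt_inner hZ hX) (mdiffAt_inner hZ' hX),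
      mvfderiv_fun_add (mdiffAt_inner hY hZ) (mdiffAt_inner hY hZ')]
    simp
    ring

theorem koszul_add (hZ : MDiffAt (T% Z) x) (hX : MDiffAt (T% X) x)
    {Y Y' : Π x : M, TangentSpace 𝓘(ℝ, E) x}
    (hY : MDiffAt (T% Y) x) (hY' : MDiffAt (T% Y') x) :
    koszul (Y + Y') X Z x = koszul Y X Z x + koszul Y' X Z x := by
  have := FiniteDimensional.complete ℝ E
  simp only [koszul, VectorField.mlieBracket_add_right hY hY',
    VectorField.mlieBracket_add_left hY hY', Pi.add_apply, inner_add_left, inner_add_right,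
    mvfderiv_fun_add (mdiffAt_inner hY hZ) (mdiffAt_inner hY' hZ),
    mvfderiv_fun_add (mdiffAt_inner hX hY) (mdiffAt_inner hX hY')]
  simp
  ring

theorem koszul_smul (hZ : MDiffAt (T% Z) x) (hX : MDiffAt (T% X) x)
    {f : M → ℝ} (hf : MDiffAt f x) (hY : MDiffAt (T% Y) x) :
    koszul (f • Y) X Z x
      = f x * koszul Y X Z x + mvfderiv 𝓘(ℝ, E) f x (X x) * ⟪Y x, Z x⟫_ℝ := by
  have := FiniteDimensional.complete ℝ E
  simp only [koszul, VectorField.mlieBracket_smul_right hf hY,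
    VectorField.mlieBracket_smul_left hf hY, Pi.smul_apply',
    real_inner_smul_left, real_inner_smul_right, inner_add_left,
    mvfderiv_fun_mul hf (mdiffAt_inner hX hY), mvfderiv_fun_mul hf (mdiffAt_inner hY hZ)]
  simp
  rw [real_inner_comm (X x) (Y x)]
  ring

/-- A connection on the tangent bundle is the Levi-Civita connection if it is compatible with the
metric and torsion-free: `∇_X Y - ∇_Y X = [X, Y]`. -/
def IsLeviCivita (cov : CovariantDerivative 𝓘(ℝ, E) E (fun x : M ↦ TangentSpace 𝓘(ℝ, E) x)) :
    Prop :=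
  CovariantDerivative.IsMetricCompatible (V := fun x : M ↦ TangentSpace 𝓘(ℝ, E) x) cov ∧
    ∀ {X Y : Π x : M, TangentSpace 𝓘(ℝ, E) x} {x : M}, MDiffAt (T% X) x → MDiffAt (T% Y) x →
      cov Y x (X x) - cov X x (Y x) = VectorField.mlieBracket 𝓘(ℝ, E) X Y x

/-- The fundamental theorem of Riemannian geometry (existence). -/
theorem exists_isLeviCivita :
    ∃ cov : CovariantDerivative 𝓘(ℝ, E) E (fun x : M ↦ TangentSpace 𝓘(ℝ, E) x),
      IsLeviCivita cov := by
  have hE := FiniteDimensional.complete ℝ E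
  have key : ∀ (Y : Π x : M, TangentSpace 𝓘(ℝ, E) x) (x : M),
      ∃ L : TangentSpace 𝓘(ℝ, E) x →L[ℝ] TangentSpace 𝓘(ℝ, E) x,
        MDiffAt (T% Y) x → ∀ {X Z : Π x : M, TangentSpace 𝓘(ℝ, E) x},
          MDiffAt (T% X) x → MDiffAt (T% Z) x → ⟪L (X x), Z x⟫_ℝ = koszul Y X Z x := by
    intro Y x
    by_cases hY : MDiffAt (T% Y) x
    · have : FiniteDimensional ℝ (TangentSpace 𝓘(ℝ, E) x) := inferInstanceAs (FiniteDimensional ℝ E)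
      have := FiniteDimensional.complete ℝ (TangentSpace 𝓘(ℝ, E) x)
      let B := TensorialAt.mkHom₂ (I := 𝓘(ℝ, E)) (fun X Z ↦ koszul Y X Z x) x
        (fun Z hZ ↦ koszul_tensorial_left hY hZ) (fun X hX ↦ koszul_tensorial_right hY hX)
      refine ⟨(((InnerProductSpace.toDual ℝ
        (TangentSpace 𝓘(ℝ, E) x)).symm.toContinuousLinearEquiv.toContinuousLinearMap :) :
        (TangentSpace 𝓘(ℝ, E) x →L[ℝ] ℝ) →SL[starRingEnd ℝ] TangentSpace 𝓘(ℝ, E) x).comp B, fun _ X Z hX hZ ↦ ?_⟩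
      simp [B, TensorialAt.mkHom₂_apply _ _ hX hZ]
    · exact ⟨0, fun h ↦ absurd h hY⟩
  choose L hL using key
  have hext : ∀ {x : M} (u v : TangentSpace 𝓘(ℝ, E) x),
      (∀ Z : Π x : M, TangentSpace 𝓘(ℝ, E) x, MDiffAt (T% Z) x → ⟪u, Z x⟫_ℝ = ⟪v, Z x⟫_ℝ) →
        u = v := by
    intro x u v h
    refine ext_inner_right ℝ fun w ↦ ?_
    simpa using h (FiberBundle.extend E w) (FiberBundle.mdifferentiableAt_extend ..)
  let cov : CovariantDerivative 𝓘(ℝ, E) E (fun x : M ↦ TangentSpace 𝓘(ℝ, E) x) :=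
    { toFun := L
      isCovariantDerivativeOnUniv :=
        { add := by
            intro Y Y' x hY hY' _
            ext v
            obtain ⟨X, hX, rfl⟩ : ∃ X : Π x : M, TangentSpace 𝓘(ℝ, E) x,
                MDiffAt (T% X) x ∧ X x = v :=
              ⟨FiberBundle.extend E v, FiberBundle.mdifferentiableAt_extend .., by simp⟩
            refine hext _ _ fun Z hZ ↦ ?_
            rw [add_apply, inner_add_left,
              hL _ _ (mdifferentiableAt_add_section hY hY') hX hZ, hL _ _ hY hX hZ,
              hL _ _ hY' hX hZ, koszul_add hZ hX hY hY']
          leibniz := by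
            intro Y f x hY hf _
            ext v
            obtain ⟨X, hX, rfl⟩ : ∃ X : Π x : M, TangentSpace 𝓘(ℝ, E) x,
                MDiffAt (T% X) x ∧ X x = v :=
              ⟨FiberBundle.extend E v, FiberBundle.mdifferentiableAt_extend .., by simp⟩
            refine hext _ _ fun Z hZ ↦ ?_
            simp only [add_apply, inner_add_left,
              smul_apply, ContinuousLinearMap.smulRight_apply,
              real_inner_smul_left, hL _ _ (hf.smul_section hY) hX hZ, hL _ _ hY hX hZ,
              koszul_smul hZ hX hf hY] } }
  refine ⟨cov, ?_, ?_⟩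
  · rw [CovariantDerivative.isMetricCompatible_iff]
    intro x X Y Z hX hY hZ
    have h1 : ⟪cov Y x (X x), Z x⟫_ℝ = koszul Y X Z x := hL _ _ hY hX hZ
    have h2 : ⟪cov Z x (X x), Y x⟫_ℝ = koszul Z X Y x := hL _ _ hZ hX hY
    beta_reduce
    rw [h1, real_inner_comm, h2, koszul, koszul, VectorField.mlieBracket_swap_apply (V := Z)]
    simp only [real_inner_comm (X _), real_inner_comm (Y _) (Z _), inner_neg_right]
    ring
  · intro X Y x hX hY
    refine hext _ _ fun Z hZ ↦ ?_
    have h1 : ⟪cov Y x (X x), Z x⟫_ℝ = koszul Y X Z x := hL _ _ hY hX hZ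
    have h2 : ⟪cov X x (Y x), Z x⟫_ℝ = koszul X Y Z x := hL _ _ hX hY hZ
    rw [inner_sub_left, h1, h2, koszul, koszul, VectorField.mlieBracket_swap_apply (V := Y) (W := X)]
    simp only [real_inner_comm (X _) (Z _), real_inner_comm (Y _) (Z _), real_inner_comm (X _) (Y _), inner_neg_left]
    ring

/-- The Levi-Civita connection of the Riemannian metric of `M`, i.e. the metric and torsion-free
connection on the tangent bundle. -/
def leviCivita (E : Type*) [NormedAddCommGroup E] [NormedSpace ℝ E] [FiniteDimensional ℝ E]
    (M : Type*) [TopologicalSpace M] [ChartedSpace E M] [IsManifold 𝓘(ℝ, E) ∞ M]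
    [RiemannianBundle (fun x : M ↦ TangentSpace 𝓘(ℝ, E) x)]
    [IsContMDiffRiemannianBundle 𝓘(ℝ, E) ∞ E (fun x : M ↦ TangentSpace 𝓘(ℝ, E) x)] :
    CovariantDerivative 𝓘(ℝ, E) E (fun x : M ↦ TangentSpace 𝓘(ℝ, E) x) :=
  (exists_isLeviCivita (E := E) (M := M)).choose

theorem isLeviCivita_leviCivita : IsLeviCivita (leviCivita E M) :=
  (exists_isLeviCivita (E := E) (M := M)).choose_spec

instance tangentSpace_finiteDimensional (x : M) : FiniteDimensional ℝ (TangentSpace 𝓘(ℝ, E) x) :=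
  inferInstanceAs (FiniteDimensional ℝ E)

/-! ### Almost contact metric structures and Kenmotsu structures -/

/-- An almost contact metric structure `(ψ, ξ, η)` on the Riemannian manifold `M` (the metric `g`
being the Riemannian metric of `M`). -/
structure AlmostContactMetricStructure (E : Type*) [NormedAddCommGroup E] [NormedSpace ℝ E]
    [FiniteDimensional ℝ E]
    (M : Type*) [TopologicalSpace M] [ChartedSpace E M] [IsManifold 𝓘(ℝ, E) ∞ M]
    [RiemannianBundle (fun x : M ↦ TangentSpace 𝓘(ℝ, E) x)]
    [IsContMDiffRiemannianBundle 𝓘(ℝ, E) ∞ E (fun x : M ↦ TangentSpace 𝓘(ℝ, E) x)] where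
  /-- the tensor field of type `(1,1)` -/
  ψ : Π x : M, TangentSpace 𝓘(ℝ, E) x →L[ℝ] TangentSpace 𝓘(ℝ, E) x
  /-- the Reeb vector field -/
  ξ : Π x : M, TangentSpace 𝓘(ℝ, E) x
  /-- the contact `1`-form -/
  η : Π x : M, TangentSpace 𝓘(ℝ, E) x →L[ℝ] ℝ
  smooth_ψ : ContMDiff 𝓘(ℝ, E) (𝓘(ℝ, E).prod 𝓘(ℝ, E →L[ℝ] E)) ∞
    (fun x ↦ TotalSpace.mk' (E →L[ℝ] E)
      (E := fun x : M ↦ TangentSpace 𝓘(ℝ, E) x →L[ℝ] TangentSpace 𝓘(ℝ, E) x) x (ψ x))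
  smooth_ξ : CMDiff ∞ (T% ξ)
  smooth_η : ContMDiff 𝓘(ℝ, E) (𝓘(ℝ, E).prod 𝓘(ℝ, E →L[ℝ] ℝ)) ∞
    (fun x ↦ TotalSpace.mk' (E →L[ℝ] ℝ)
      (E := fun x : M ↦ TangentSpace 𝓘(ℝ, E) x →L[ℝ] ℝ) x (η x))
  ψ_ψ : ∀ x (u : TangentSpace 𝓘(ℝ, E) x), ψ x (ψ x u) = -u + η x u • ξ x
  ψ_ξ : ∀ x, ψ x (ξ x) = 0
  η_ψ : ∀ x (u : TangentSpace 𝓘(ℝ, E) x), η x (ψ x u) = 0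
  η_ξ : ∀ x, η x (ξ x) = 1
  inner_ψ_ψ : ∀ x (u v : TangentSpace 𝓘(ℝ, E) x), ⟪ψ x u, ψ x v⟫_ℝ = ⟪u, v⟫_ℝ - η x u * η x v
  inner_ψ_left : ∀ x (u v : TangentSpace 𝓘(ℝ, E) x), ⟪ψ x u, v⟫_ℝ = -⟪u, ψ x v⟫_ℝ
  η_eq_inner : ∀ x (u : TangentSpace 𝓘(ℝ, E) x), η x u = ⟪u, ξ x⟫_ℝ

/-- A Kenmotsu structure: `(∇_X ψ) Y = g(ψ X, Y) ξ - η(Y) ψ X` and `∇_X ξ = X - η(X) ξ`,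
where `(∇_X ψ) Y = ∇_X (ψ Y) - ψ (∇_X Y)`. -/
structure KenmotsuStructure (E : Type*) [NormedAddCommGroup E] [NormedSpace ℝ E]
    [FiniteDimensional ℝ E]
    (M : Type*) [TopologicalSpace M] [ChartedSpace E M] [IsManifold 𝓘(ℝ, E) ∞ M]
    [RiemannianBundle (fun x : M ↦ TangentSpace 𝓘(ℝ, E) x)]
    [IsContMDiffRiemannianBundle 𝓘(ℝ, E) ∞ E (fun x : M ↦ TangentSpace 𝓘(ℝ, E) x)]
    extends AlmostContactMetricStructure E M where
  nabla_ψ : ∀ X Y : Π x : M, TangentSpace 𝓘(ℝ, E) x, CMDiff ∞ (T% X) → CMDiff ∞ (T% Y) → ∀ x : M,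
    leviCivita E M (fun y ↦ ψ y (Y y)) x (X x) - ψ x (leviCivita E M Y x (X x))
      = ⟪ψ x (X x), Y x⟫_ℝ • ξ x - η x (Y x) • ψ x (X x)
  nabla_ξ : ∀ X : Π x : M, TangentSpace 𝓘(ℝ, E) x, CMDiff ∞ (T% X) → ∀ x : M,
    leviCivita E M ξ x (X x) = X x - η x (X x) • ξ x

end RiemGeom

/-! ### Riemannian maps -/

namespace RiemMap

open RiemGeom

variable {E₁ : Type*} [NormedAddCommGroup E₁] [NormedSpace ℝ E₁] [FiniteDimensional ℝ E₁]
  {N : Type*} [TopologicalSpace N] [ChartedSpace E₁ N] [IsManifold 𝓘(ℝ, E₁) ∞ N]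
  [RiemannianBundle (fun p : N ↦ TangentSpace 𝓘(ℝ, E₁) p)]
  [IsContMDiffRiemannianBundle 𝓘(ℝ, E₁) ∞ E₁ (fun p : N ↦ TangentSpace 𝓘(ℝ, E₁) p)]
  {E₂ : Type*} [NormedAddCommGroup E₂] [NormedSpace ℝ E₂] [FiniteDimensional ℝ E₂]
  {M : Type*} [TopologicalSpace M] [ChartedSpace E₂ M] [IsManifold 𝓘(ℝ, E₂) ∞ M]
  [RiemannianBundle (fun x : M ↦ TangentSpace 𝓘(ℝ, E₂) x)]
  [IsContMDiffRiemannianBundle 𝓘(ℝ, E₂) ∞ E₂ (fun x : M ↦ TangentSpace 𝓘(ℝ, E₂) x)]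

/-- The differential `F_{*p} : T_p N → T_{F p} M`. -/
def push (F : C^∞⟮𝓘(ℝ, E₁), N; 𝓘(ℝ, E₂), M⟯) (p : N) :
    TangentSpace 𝓘(ℝ, E₁) p →ₗ[ℝ] TangentSpace 𝓘(ℝ, E₂) (F p) :=
  (mfderiv 𝓘(ℝ, E₁) 𝓘(ℝ, E₂) F p).toLinearMap

/-- The horizontal space `(ker F_{*p})^⊥`. -/
def hor (F : C^∞⟮𝓘(ℝ, E₁), N; 𝓘(ℝ, E₂), M⟯) (p : N) : Submodule ℝ (TangentSpace 𝓘(ℝ, E₁) p) :=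
  (LinearMap.ker (push F p))ᗮ

/-- The space `range F_{*p}`. -/
def ran (F : C^∞⟮𝓘(ℝ, E₁), N; 𝓘(ℝ, E₂), M⟯) (p : N) :
    Submodule ℝ (TangentSpace 𝓘(ℝ, E₂) (F p)) :=
  LinearMap.range (push F p)

/-- The adjoint `*F_{*p} : T_{F p} M → T_p N` of the differential. -/
def adj (F : C^∞⟮𝓘(ℝ, E₁), N; 𝓘(ℝ, E₂), M⟯) (p : N) :
    TangentSpace 𝓘(ℝ, E₂) (F p) →ₗ[ℝ] TangentSpace 𝓘(ℝ, E₁) p :=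
  LinearMap.adjoint (push F p)

/-- Orthogonal projection of `T_{F p} M` onto `range F_{*p}`. -/
def tanPart (F : C^∞⟮𝓘(ℝ, E₁), N; 𝓘(ℝ, E₂), M⟯) (p : N) (v : TangentSpace 𝓘(ℝ, E₂) (F p)) :
    TangentSpace 𝓘(ℝ, E₂) (F p) :=
  (ran F p).starProjection v

/-- Orthogonal projection of `T_{F p} M` onto `(range F_{*p})^⊥`. -/
def norPart (F : C^∞⟮𝓘(ℝ, E₁), N; 𝓘(ℝ, E₂), M⟯) (p : N) (v : TangentSpace 𝓘(ℝ, E₂) (F p)) :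
    TangentSpace 𝓘(ℝ, E₂) (F p) :=
  (ran F p)ᗮ.starProjection v

/-- `F` is a Riemannian map: `F_*` is isometric on horizontal vectors. No condition on the rank is
imposed, so isometric immersions and Riemannian submersions are included. -/
def IsRiemannianMap (F : C^∞⟮𝓘(ℝ, E₁), N; 𝓘(ℝ, E₂), M⟯) : Prop :=
  ∀ p : N, ∀ u ∈ hor F p, ∀ v ∈ hor F p, ⟪push F p u, push F p v⟫_ℝ = ⟪u, v⟫_ℝ

/-- The pullback connection `∇^F` of the Levi-Civita connection of `M` along `F`, evaluated on a
section `V` of `F^* TM` in the direction `u ∈ T_p N`: if `V = ∑ᵢ Vⁱ (eᵢ ∘ F)` for the coordinate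
frame `(eᵢ)` of `TM` around `F p`, then `∇^F_u V = ∑ᵢ (dVⁱ(u) eᵢ + Vⁱ(p) ∇_{F_* u} eᵢ)`. -/
def pullbackConn (F : C^∞⟮𝓘(ℝ, E₁), N; 𝓘(ℝ, E₂), M⟯)
    (V : Π p : N, TangentSpace 𝓘(ℝ, E₂) (F p)) (p : N) (u : TangentSpace 𝓘(ℝ, E₁) p) :
    TangentSpace 𝓘(ℝ, E₂) (F p) :=
  let e := trivializationAt E₂ (fun x : M ↦ TangentSpace 𝓘(ℝ, E₂) x) (F p)
  let b := Module.finBasis ℝ E₂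
  ∑ i, (mvfderiv 𝓘(ℝ, E₁) (fun q : N ↦ e.localFrameCoeff 𝓘(ℝ, E₂) b i (F q) (V q)) p u •
      e.localFrame b i (F p)
    + e.localFrameCoeff 𝓘(ℝ, E₂) b i (F p) (V p) •
      leviCivita E₂ M (e.localFrame b i) (F p) (push F p u))

/-- The second fundamental form `(∇F_*)(X, Y) = ∇^F_X F_*Y - F_*(∇_X Y)`. -/
def secondFF (F : C^∞⟮𝓘(ℝ, E₁), N; 𝓘(ℝ, E₂), M⟯) (X Y : Π p : N, TangentSpace 𝓘(ℝ, E₁) p)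
    (p : N) : TangentSpace 𝓘(ℝ, E₂) (F p) :=
  pullbackConn F (fun q ↦ push F q (Y q)) p (X p) - push F p (leviCivita E₁ N Y p (X p))

/-- `S_V F_*X`: minus the `range F_*` component of `∇^F_X V`. -/
def shape (F : C^∞⟮𝓘(ℝ, E₁), N; 𝓘(ℝ, E₂), M⟯) (V : Π p : N, TangentSpace 𝓘(ℝ, E₂) (F p))
    (X : Π p : N, TangentSpace 𝓘(ℝ, E₁) p) (p : N) : TangentSpace 𝓘(ℝ, E₂) (F p) :=
  -tanPart F p (pullbackConn F V p (X p))

/-- `∇^{F⊥}_X V`: the `(range F_*)^⊥` component of `∇^F_X V`. -/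
def normalConn (F : C^∞⟮𝓘(ℝ, E₁), N; 𝓘(ℝ, E₂), M⟯) (V : Π p : N, TangentSpace 𝓘(ℝ, E₂) (F p))
    (X : Π p : N, TangentSpace 𝓘(ℝ, E₁) p) (p : N) : TangentSpace 𝓘(ℝ, E₂) (F p) :=
  norPart F p (pullbackConn F V p (X p))

/-- Smooth horizontal vector fields: the sections `Γ((ker F_*)^⊥)`. -/
def IsHorizontalField (F : C^∞⟮𝓘(ℝ, E₁), N; 𝓘(ℝ, E₂), M⟯)
    (X : Π p : N, TangentSpace 𝓘(ℝ, E₁) p) : Prop :=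
  CMDiff ∞ (T% X) ∧ ∀ p, X p ∈ hor F p

/-- `range F_*` defines a totally geodesic foliation: `∇_{F_*X} F_*Y ∈ Γ(range F_*)` for all
`X, Y ∈ Γ((ker F_*)^⊥)`, where the derivative of `F_*Y` in the direction `F_*X` is taken with the
pullback connection along `F`. (Integrability is contained in this: by torsion-freeness
`∇_{F_*X} F_*Y - ∇_{F_*Y} F_*X = F_*[X, Y]`; the leaves are locally the images of `F`.) -/
def RangeTotallyGeodesic (F : C^∞⟮𝓘(ℝ, E₁), N; 𝓘(ℝ, E₂), M⟯) : Prop :=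
  ∀ X Y : Π p : N, TangentSpace 𝓘(ℝ, E₁) p, IsHorizontalField F X → IsHorizontalField F Y →
    ∀ p, pullbackConn F (fun q ↦ push F q (Y q)) p (X p) ∈ ran F p

/-! ### Bi-slant Riemannian maps -/

/-- A smooth distribution along `F`: a family of subspaces `D p ⊆ T_{F p} M` which is locally the
span of a smooth frame. -/
def IsSmoothDistribution (F : C^∞⟮𝓘(ℝ, E₁), N; 𝓘(ℝ, E₂), M⟯)
    (D : Π p : N, Submodule ℝ (TangentSpace 𝓘(ℝ, E₂) (F p))) : Prop :=
  ∀ p₀ : N, ∃ U ∈ 𝓝 p₀, ∃ (r : ℕ) (s : Fin r → Π p : N, TangentSpace 𝓘(ℝ, E₂) (F p)),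
    (∀ i, ContMDiffOn 𝓘(ℝ, E₁) 𝓘(ℝ, E₂).tangent ∞
      (fun p ↦ (⟨F p, s i p⟩ : TangentBundle 𝓘(ℝ, E₂) M)) U) ∧
    ∀ p ∈ U, LinearIndependent ℝ (fun i ↦ s i p) ∧
      Submodule.span ℝ (Set.range fun i ↦ s i p) = D p

/-- `D` is slant with slant angle `θ`: for every `v ∈ D p` the angle between `ψ v` and the
subspace `D p` is `θ`, i.e. the orthogonal projection of `ψ v` to `D p` has length `cos θ ‖ψ v‖`. -/
def IsSlant (K : KenmotsuStructure E₂ M) (F : C^∞⟮𝓘(ℝ, E₁), N; 𝓘(ℝ, E₂), M⟯)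
    (D : Π p : N, Submodule ℝ (TangentSpace 𝓘(ℝ, E₂) (F p))) (θ : ℝ) : Prop :=
  θ ∈ Set.Icc 0 (Real.pi / 2) ∧
    ∀ p, ∀ v ∈ D p, ‖(D p).starProjection (K.ψ (F p) v)‖ = Real.cos θ * ‖K.ψ (F p) v‖

/-- Bi-slant Riemannian maps to a Kenmotsu manifold: `range F_*` is the orthogonal sum of two slant
distributions `D₁`, `D₂` with `ψ D₁ ⊥ D₂`, `ψ D₂ ⊥ D₁`, and of `ℝ ξ` if `ξ ∈ Γ(range F_*)`,
respectively of `D₁` and `D₂` only if `ξ ∈ Γ((range F_*)^⊥)`. -/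
def IsBiSlantRiemannianMap (K : KenmotsuStructure E₂ M)
    (F : C^∞⟮𝓘(ℝ, E₁), N; 𝓘(ℝ, E₂), M⟯) : Prop :=
  IsRiemannianMap F ∧
  ∃ (D₁ D₂ : Π p : N, Submodule ℝ (TangentSpace 𝓘(ℝ, E₂) (F p))) (θ₁ θ₂ : ℝ),
    IsSmoothDistribution F D₁ ∧ IsSmoothDistribution F D₂ ∧
    IsSlant K F D₁ θ₁ ∧ IsSlant K F D₂ θ₂ ∧
    (∀ p, D₁ p ⟂ D₂ p) ∧
    (∀ p, ∀ u ∈ D₁ p, ∀ v ∈ D₂ p, ⟪K.ψ (F p) u, v⟫_ℝ = 0 ∧ ⟪K.ψ (F p) v, u⟫_ℝ = 0) ∧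
    ((∀ p, K.ξ (F p) ∈ ran F p ∧ D₁ p ⟂ ℝ ∙ K.ξ (F p) ∧ D₂ p ⟂ ℝ ∙ K.ξ (F p) ∧
        ran F p = D₁ p ⊔ D₂ p ⊔ ℝ ∙ K.ξ (F p)) ∨
      (∀ p, K.ξ (F p) ∈ (ran F p)ᗮ ∧ ran F p = D₁ p ⊔ D₂ p))

/-- `P w`: the `range F_*` component of `ψ w`, for `w ∈ range F_{*p}`. -/
def opP (K : KenmotsuStructure E₂ M) (F : C^∞⟮𝓘(ℝ, E₁), N; 𝓘(ℝ, E₂), M⟯) (p : N)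
    (w : TangentSpace 𝓘(ℝ, E₂) (F p)) : TangentSpace 𝓘(ℝ, E₂) (F p) :=
  tanPart F p (K.ψ (F p) w)

/-- `Q w`: the `(range F_*)^⊥` component of `ψ w`, for `w ∈ range F_{*p}`. -/
def opQ (K : KenmotsuStructure E₂ M) (F : C^∞⟮𝓘(ℝ, E₁), N; 𝓘(ℝ, E₂), M⟯) (p : N)
    (w : TangentSpace 𝓘(ℝ, E₂) (F p)) : TangentSpace 𝓘(ℝ, E₂) (F p) :=
  norPart F p (K.ψ (F p) w)

/-- `ω v`: the `(range F_*)^⊥` component of `ψ v`, for `v ∈ (range F_{*p})^⊥`. -/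
def opω (K : KenmotsuStructure E₂ M) (F : C^∞⟮𝓘(ℝ, E₁), N; 𝓘(ℝ, E₂), M⟯) (p : N)
    (v : TangentSpace 𝓘(ℝ, E₂) (F p)) : TangentSpace 𝓘(ℝ, E₂) (F p) :=
  norPart F p (K.ψ (F p) v)

end RiemMap

end

open RiemGeom RiemMap

/-! Write W = F_*Y. Along F the Kenmotsu condition on ∇ψ reads ∇^F_X(ψW) = ψ(∇^F_X W) + g(ψF_*X, W)ξ
- η(W)ψF_*X. Apply ψ and take the component normal to range F_*. Since ψ² = -I + η⊗ξ and ψξ = 0, the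
correction terms become multiples of F_*X and ξ, both tangent, so the normal part of ∇^F_X W is
minus that of ψ(∇^F_X ψW). Now split ψW = PW + QW. As F is a Riemannian map, PW = F_*(*F_*PW), so
∇^F_X PW is a value of the second fundamental form plus F_*(∇_X *F_*PW), while ∇^F_X QW =
-S_{QW}F_*X + ∇^{F⊥}_X QW. Hence the normal part of ∇^F_X F_*Y is exactly the difference of the two
sides of the stated equation (`norPart_pullbackConn_push`), and it vanishes iff they agree.

Two points need work: transporting the identity for ∇ψ from fields on M to sections along F
(`pullbackConn_ψ`), and the differentiability of PW and QW, without which ∇^F need not be additive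
on them. The latter holds because range F_* is an orthogonal sum of smooth distributions and ℝξ
(`MDiffAlongAt.tanPart`). -/

noncomputable section

namespace RiemMap

open Bundle.Trivialization

variable {E₁ : Type*} [NormedAddCommGroup E₁] [NormedSpace ℝ E₁] [FiniteDimensional ℝ E₁]
  {N : Type*} [TopologicalSpace N] [ChartedSpace E₁ N] [IsManifold 𝓘(ℝ, E₁) ∞ N]
  [RiemannianBundle (fun p : N ↦ TangentSpace 𝓘(ℝ, E₁) p)]
  [IsContMDiffRiemannianBundle 𝓘(ℝ, E₁) ∞ E₁ (fun p : N ↦ TangentSpace 𝓘(ℝ, E₁) p)]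
  {E₂ : Type*} [NormedAddCommGroup E₂] [NormedSpace ℝ E₂] [FiniteDimensional ℝ E₂]
  {M : Type*} [TopologicalSpace M] [ChartedSpace E₂ M] [IsManifold 𝓘(ℝ, E₂) ∞ M]
  [RiemannianBundle (fun x : M ↦ TangentSpace 𝓘(ℝ, E₂) x)]
  [IsContMDiffRiemannianBundle 𝓘(ℝ, E₂) ∞ E₂ (fun x : M ↦ TangentSpace 𝓘(ℝ, E₂) x)]
  {F : C^∞⟮𝓘(ℝ, E₁), N; 𝓘(ℝ, E₂), M⟯} {p : N}

/-! ### Sections along F and their frame coefficients -/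

/-- Differentiability at `p` of a section `V` of `F^* TM`. -/
def MDiffAlongAt (F : C^∞⟮𝓘(ℝ, E₁), N; 𝓘(ℝ, E₂), M⟯)
    (V : Π p : N, TangentSpace 𝓘(ℝ, E₂) (F p)) (p : N) : Prop :=
  MDifferentiableAt 𝓘(ℝ, E₁) 𝓘(ℝ, E₂).tangent
    (fun q ↦ (⟨F q, V q⟩ : TangentBundle 𝓘(ℝ, E₂) M)) p

/-- The `i`-th coefficient of `V` in the coordinate frame of `TM` around `F p`. -/
def frameCoeff (F : C^∞⟮𝓘(ℝ, E₁), N; 𝓘(ℝ, E₂), M⟯) (p : N)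
    (i : Fin (Module.finrank ℝ E₂)) (V : Π p : N, TangentSpace 𝓘(ℝ, E₂) (F p)) (q : N) : ℝ :=
  (trivializationAt E₂ (fun x : M ↦ TangentSpace 𝓘(ℝ, E₂) x) (F p)).localFrameCoeff
    𝓘(ℝ, E₂) (Module.finBasis ℝ E₂) i (F q) (V q)

/-- The coordinate frame of `TM` around `x`. -/
def coordFrame (x : M) (i : Fin (Module.finrank ℝ E₂)) : Π y : M, TangentSpace 𝓘(ℝ, E₂) y :=
  (trivializationAt E₂ (fun x : M ↦ TangentSpace 𝓘(ℝ, E₂) x) x).localFrame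
    (Module.finBasis ℝ E₂) i

theorem pullbackConn_eq (V : Π p : N, TangentSpace 𝓘(ℝ, E₂) (F p))
    (u : TangentSpace 𝓘(ℝ, E₁) p) :
    pullbackConn F V p u = ∑ i, (mvfderiv 𝓘(ℝ, E₁) (frameCoeff F p i V) p u •
      coordFrame (F p) i (F p)
      + frameCoeff F p i V p • leviCivita E₂ M (coordFrame (F p) i) (F p) (push F p u)) :=
  rfl

theorem mdifferentiableAt_map (F : C^∞⟮𝓘(ℝ, E₁), N; 𝓘(ℝ, E₂), M⟯) (p : N) :
    MDifferentiableAt 𝓘(ℝ, E₁) 𝓘(ℝ, E₂) F p :=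
  F.contMDiff.contMDiffAt.mdifferentiableAt (by simp)

theorem eventually_mem_baseSet (F : C^∞⟮𝓘(ℝ, E₁), N; 𝓘(ℝ, E₂), M⟯) (p : N) :
    ∀ᶠ q in 𝓝 p, F q ∈ (trivializationAt E₂ (fun x : M ↦ TangentSpace 𝓘(ℝ, E₂) x) (F p)).baseSet :=
  (mdifferentiableAt_map F p).continuousAt.eventually
    ((Trivialization.open_baseSet _).mem_nhds
      (mem_baseSet_trivializationAt E₂ (fun x : M ↦ TangentSpace 𝓘(ℝ, E₂) x) (F p)))

theorem frameCoeff_eq_repr {V : Π p : N, TangentSpace 𝓘(ℝ, E₂) (F p)}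
    {q : N} (hq : F q ∈ (trivializationAt E₂ (fun x : M ↦ TangentSpace 𝓘(ℝ, E₂) x) (F p)).baseSet)
    (i : Fin (Module.finrank ℝ E₂)) :
    frameCoeff F p i V q = (Module.finBasis ℝ E₂).repr
      (trivializationAt E₂ (fun x : M ↦ TangentSpace 𝓘(ℝ, E₂) x) (F p) ⟨F q, V q⟩).2 i := by
  -- The coefficient depends only on the value at F q, so V q may be extended by zero to a section
  -- of TM, whether or not F is injective.
  obtain ⟨s, hs⟩ : ∃ s : Π x : M, TangentSpace 𝓘(ℝ, E₂) x, s (F q) = V q := by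
    classical
    exact ⟨Function.update (fun _ ↦ 0) (F q) (V q), by simp⟩
  rw [frameCoeff, ← hs]
  exact localFrameCoeff_eq_coeff _ hq

theorem sum_frameCoeff_smul {V : Π p : N, TangentSpace 𝓘(ℝ, E₂) (F p)}
    {q : N} (hq : F q ∈ (trivializationAt E₂ (fun x : M ↦ TangentSpace 𝓘(ℝ, E₂) x) (F p)).baseSet) :
    V q = ∑ i, frameCoeff F p i V q • coordFrame (F p) i (F q) := by
  obtain ⟨s, hs⟩ : ∃ s : Π x : M, TangentSpace 𝓘(ℝ, E₂) x, s (F q) = V q := by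
    classical
    exact ⟨Function.update (fun _ ↦ 0) (F q) (V q), by simp⟩
  simp only [frameCoeff, ← hs]
  exact eq_sum_localFrameCoeff_smul hq

/-- The pullback connection is defined through frame coefficients; this turns differentiability of a
section into the differentiability of the functions it differentiates. Near p they are the
coordinates, in a fixed basis of E₂, of the section read in the trivialization. -/
theorem mdiffAlongAt_iff_frameCoeff {V : Π p : N, TangentSpace 𝓘(ℝ, E₂) (F p)} :
    MDiffAlongAt F V p ↔
      ∀ i, MDifferentiableAt 𝓘(ℝ, E₁) 𝓘(ℝ, ℝ) (frameCoeff F p i V) p := by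
  set e := trivializationAt E₂ (fun x : M ↦ TangentSpace 𝓘(ℝ, E₂) x) (F p)
  set b := Module.finBasis ℝ E₂
  have h1 : MDiffAlongAt F V p ↔
      MDifferentiableAt 𝓘(ℝ, E₁) 𝓘(ℝ, E₂) (fun q ↦ (e ⟨F q, V q⟩).2) p := by
    rw [MDiffAlongAt, ModelWithCorners.tangent, mdifferentiableAt_totalSpace]
    exact and_iff_right (mdifferentiableAt_map F p)
  have h2 : ∀ i, frameCoeff F p i V =ᶠ[𝓝 p] fun q ↦ b.repr (e ⟨F q, V q⟩).2 i := fun i ↦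
    (eventually_mem_baseSet F p).mono fun q hq ↦ frameCoeff_eq_repr hq i
  rw [h1]
  constructor
  · intro h i
    refine MDifferentiableAt.congr_of_eventuallyEq ?_ (h2 i)
    have : MDifferentiableAt 𝓘(ℝ, E₂) 𝓘(ℝ, ℝ) (b.coord i).toContinuousLinearMap
        (e ⟨F p, V p⟩).2 :=
      mdifferentiableAt_iff_differentiableAt.mpr (by fun_prop)
    exact this.comp p h
  · intro h
    have h3 : MDifferentiableAt 𝓘(ℝ, E₁) 𝓘(ℝ, E₂)
        (∑ i, fun q ↦ b.repr (e ⟨F q, V q⟩).2 i • b i) p :=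
      MDifferentiableAt.sum fun i _ ↦
        ((h i).congr_of_eventuallyEq (h2 i).symm).smul mdifferentiableAt_const
    refine h3.congr_of_eventuallyEq (.of_forall fun q ↦ ?_)
    simp [b.sum_repr]

/-! ### Additivity, Leibniz rule and locality of the pullback connection -/

section
variable {V W : Π p : N, TangentSpace 𝓘(ℝ, E₂) (F p)} {f : N → ℝ}

theorem frameCoeff_add (i : Fin (Module.finrank ℝ E₂)) :
    frameCoeff F p i (fun q ↦ V q + W q) = fun q ↦ frameCoeff F p i V q + frameCoeff F p i W q :=
  funext fun _ ↦ map_add _ _ _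

theorem frameCoeff_smul (i : Fin (Module.finrank ℝ E₂)) :
    frameCoeff F p i (fun q ↦ f q • V q) = fun q ↦ f q * frameCoeff F p i V q :=
  funext fun _ ↦ map_smul _ _ _

theorem frameCoeff_zero (i : Fin (Module.finrank ℝ E₂)) :
    frameCoeff F p i (fun _ ↦ 0) = fun _ ↦ 0 :=
  funext fun _ ↦ map_zero _

theorem MDiffAlongAt.add (hV : MDiffAlongAt F V p) (hW : MDiffAlongAt F W p) :
    MDiffAlongAt F (fun q ↦ V q + W q) p := by
  rw [mdiffAlongAt_iff_frameCoeff] at *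
  intro i
  rw [frameCoeff_add]
  exact (hV i).add (hW i)

theorem MDiffAlongAt.smul (hf : MDifferentiableAt 𝓘(ℝ, E₁) 𝓘(ℝ, ℝ) f p)
    (hV : MDiffAlongAt F V p) : MDiffAlongAt F (fun q ↦ f q • V q) p := by
  rw [mdiffAlongAt_iff_frameCoeff] at *
  intro i
  rw [frameCoeff_smul]
  exact hf.mul (hV i)

theorem mdiffAlongAt_zero : MDiffAlongAt F (fun _ ↦ 0) p := by
  rw [mdiffAlongAt_iff_frameCoeff]
  intro i
  rw [frameCoeff_zero]
  exact mdifferentiableAt_const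

theorem MDiffAlongAt.sub (hV : MDiffAlongAt F V p) (hW : MDiffAlongAt F W p) :
    MDiffAlongAt F (fun q ↦ V q - W q) p := by
  have := hV.add (hW.smul (f := fun _ ↦ -1) mdifferentiableAt_const)
  simpa [sub_eq_add_neg] using this

theorem MDiffAlongAt.sum {ι : Type*} {s : Finset ι}
    {V : ι → Π p : N, TangentSpace 𝓘(ℝ, E₂) (F p)} (hV : ∀ i ∈ s, MDiffAlongAt F (V i) p) :
    MDiffAlongAt F (fun q ↦ ∑ i ∈ s, V i q) p := by
  classical
  induction s using Finset.induction_on with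
  | empty => simpa using mdiffAlongAt_zero
  | insert a s ha ih =>
    simp only [Finset.sum_insert ha]
    exact (hV a (by simp)).add (ih fun i hi ↦ hV i (by simp [hi]))

theorem MDiffAlongAt.congr (hV : MDiffAlongAt F V p) (h : ∀ᶠ q in 𝓝 p, W q = V q) :
    MDiffAlongAt F W p :=
  MDifferentiableAt.congr_of_eventuallyEq hV (h.mono fun q hq ↦ by simp [hq])

theorem MDiffAlongAt.inner (hV : MDiffAlongAt F V p) (hW : MDiffAlongAt F W p) :
    MDifferentiableAt 𝓘(ℝ, E₁) 𝓘(ℝ, ℝ) (fun q ↦ ⟪V q, W q⟫_ℝ) p :=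
  MDifferentiableAt.inner_bundle (IB := 𝓘(ℝ, E₂)) (F := E₂)
    (E := fun x : M ↦ TangentSpace 𝓘(ℝ, E₂) x) (b := F) hV hW

theorem mdiffAlongAt_comp {Z : Π x : M, TangentSpace 𝓘(ℝ, E₂) x} (hZ : MDiffAt (T% Z) (F p)) :
    MDiffAlongAt F (fun q ↦ Z (F q)) p :=
  MDifferentiableAt.comp p hZ (mdifferentiableAt_map F p)

theorem pullbackConn_add (hV : MDiffAlongAt F V p) (hW : MDiffAlongAt F W p)
    (u : TangentSpace 𝓘(ℝ, E₁) p) :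
    pullbackConn F (fun q ↦ V q + W q) p u = pullbackConn F V p u + pullbackConn F W p u := by
  rw [mdiffAlongAt_iff_frameCoeff] at *
  simp only [pullbackConn_eq, frameCoeff_add, ← Finset.sum_add_distrib]
  refine Finset.sum_congr rfl fun i _ ↦ ?_
  rw [mvfderiv_fun_add (hV i) (hW i), add_apply]
  module

theorem pullbackConn_smul (hf : MDifferentiableAt 𝓘(ℝ, E₁) 𝓘(ℝ, ℝ) f p)
    (hV : MDiffAlongAt F V p) (u : TangentSpace 𝓘(ℝ, E₁) p) :
    pullbackConn F (fun q ↦ f q • V q) p u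
      = mvfderiv 𝓘(ℝ, E₁) f p u • V p + f p • pullbackConn F V p u := by
  rw [mdiffAlongAt_iff_frameCoeff] at hV
  have hp := sum_frameCoeff_smul (p := p) (V := V) (q := p) (eventually_mem_baseSet F p).self_of_nhds
  -- The term df(u) V p has to be expanded in the frame to match the left side summand by summand.
  conv_rhs => rw [hp]
  simp only [pullbackConn_eq, frameCoeff_smul, Finset.smul_sum, ← Finset.sum_add_distrib]
  refine Finset.sum_congr rfl fun i _ ↦ ?_
  rw [mvfderiv_fun_mul hf (hV i)]
  simp only [add_apply, smul_apply, smul_eq_mul]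
  module

theorem pullbackConn_zero (u : TangentSpace 𝓘(ℝ, E₁) p) :
    pullbackConn F (fun _ ↦ 0) p u = 0 := by
  simp [pullbackConn_eq, frameCoeff_zero, mvfderiv_const]

theorem pullbackConn_congr (h : ∀ᶠ q in 𝓝 p, V q = W q) (u : TangentSpace 𝓘(ℝ, E₁) p) :
    pullbackConn F V p u = pullbackConn F W p u := by
  have h1 : ∀ i, frameCoeff F p i V =ᶠ[𝓝 p] frameCoeff F p i W := fun i ↦
    h.mono fun q hq ↦ by simp only [frameCoeff, hq]
  rw [pullbackConn_eq, pullbackConn_eq]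
  refine Finset.sum_congr rfl fun i _ ↦ ?_
  have h2 : mvfderiv 𝓘(ℝ, E₁) (frameCoeff F p i V) p u
      = mvfderiv 𝓘(ℝ, E₁) (frameCoeff F p i W) p u :=
    DFunLike.congr_fun (h1 i).mfderiv_eq u
  rw [h2, (h1 i).self_of_nhds]

theorem pullbackConn_sum {ι : Type*} {s : Finset ι}
    {V : ι → Π p : N, TangentSpace 𝓘(ℝ, E₂) (F p)} (hV : ∀ i ∈ s, MDiffAlongAt F (V i) p)
    (u : TangentSpace 𝓘(ℝ, E₁) p) :
    pullbackConn F (fun q ↦ ∑ i ∈ s, V i q) p u = ∑ i ∈ s, pullbackConn F (V i) p u := by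
  classical
  induction s using Finset.induction_on with
  | empty => simpa using pullbackConn_zero u
  | insert a s ha ih =>
    simp only [Finset.sum_insert ha]
    rw [pullbackConn_add (hV a (by simp)) (.sum fun i hi ↦ hV i (by simp [hi])),
      ih fun i hi ↦ hV i (by simp [hi])]

end

/-! ### Pullback connection on restrictions of vector fields of M -/

theorem coordFrame_mdiffAt (x : M) (i : Fin (Module.finrank ℝ E₂)) :
    MDiffAt (T% (coordFrame (E₂ := E₂) x i)) x :=
  (contMDiffAt_localFrame_of_mem ∞ _ _ _
    (mem_baseSet_trivializationAt E₂ _ x)).mdifferentiableAt (by simp)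

theorem covariantDerivative_sum_smul {ι : Type*}
    (cov : CovariantDerivative 𝓘(ℝ, E₂) E₂ (fun x : M ↦ TangentSpace 𝓘(ℝ, E₂) x))
    {s : Finset ι} {f : ι → M → ℝ} {Z : ι → Π x : M, TangentSpace 𝓘(ℝ, E₂) x} {x : M}
    (hf : ∀ i ∈ s, MDiffAt (f i) x) (hZ : ∀ i ∈ s, MDiffAt (T% (Z i)) x)
    (u : TangentSpace 𝓘(ℝ, E₂) x) :
    cov (∑ i ∈ s, f i • Z i) x u
      = ∑ i ∈ s, (mvfderiv 𝓘(ℝ, E₂) (f i) x u • Z i x + f i x • cov (Z i) x u) := by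
  classical
  induction s using Finset.induction_on with
  | empty => simp
  | insert a s ha ih =>
    have h1 : MDiffAt (T% (∑ i ∈ s, f i • Z i)) x := by
      have := MDifferentiableAt.sum_section (I := 𝓘(ℝ, E₂)) (F := E₂) (s := s)
        (t := fun i ↦ f i • Z i) (x₀ := x)
        fun i hi ↦ (hf i (by simp [hi])).smul_section (hZ i (by simp [hi]))
      simpa [Finset.sum_apply] using this
    rw [Finset.sum_insert ha, Finset.sum_insert ha,
      cov.isCovariantDerivativeOnUniv.add
        ((hf a (by simp)).smul_section (hZ a (by simp))) h1,
      cov.isCovariantDerivativeOnUniv.leibniz (hZ a (by simp)) (hf a (by simp)),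
      add_apply, ih (fun i hi ↦ hf i (by simp [hi])) (fun i hi ↦ hZ i (by simp [hi]))]
    simp
    abel

/-- The pullback connection on the restriction to `F` of a vector field of the target. -/
theorem pullbackConn_comp {Z : Π x : M, TangentSpace 𝓘(ℝ, E₂) x} (hZ : MDiffAt (T% Z) (F p))
    (u : TangentSpace 𝓘(ℝ, E₁) p) :
    pullbackConn F (fun q ↦ Z (F q)) p u = leviCivita E₂ M Z (F p) (push F p u) := by
  set e := trivializationAt E₂ (fun x : M ↦ TangentSpace 𝓘(ℝ, E₂) x) (F p) with he
  set b := Module.finBasis ℝ E₂ with hb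
  have hmem := mem_baseSet_trivializationAt E₂ (fun x : M ↦ TangentSpace 𝓘(ℝ, E₂) x) (F p)
  let c : Fin (Module.finrank ℝ E₂) → M → ℝ := fun i x ↦ e.localFrameCoeff 𝓘(ℝ, E₂) b i x (Z x)
  have hc : ∀ i, MDiffAt (c i) (F p) := fun i ↦ mdifferentiableAt_localFrameCoeff b hmem hZ i
  have hfr := coordFrame_mdiffAt (E₂ := E₂) (F p)
  have hsum : ∀ᶠ x in 𝓝 (F p), Z x = (∑ i, c i • coordFrame (F p) i) x := by
    filter_upwards [eventually_eq_localFrame_sum_coeff_smul (I := 𝓘(ℝ, E₂)) e b (s := Z) hmem]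
      with x hx
    rw [hx]
    simp [c, coordFrame, he, hb, Finset.sum_apply]
  have hsd : MDiffAt (T% (∑ i, c i • coordFrame (F p) i)) (F p) :=
    hZ.congr_of_eventuallyEq (hsum.mono fun x hx ↦ by simp [hx])
  rw [(leviCivita E₂ M).isCovariantDerivativeOnUniv.congr_of_eventuallyEq hZ hsd
    Filter.univ_mem hsum, covariantDerivative_sum_smul _ (fun i _ ↦ hc i) (fun i _ ↦ hfr i),
    pullbackConn_eq]
  refine Finset.sum_congr rfl fun i _ ↦ ?_
  -- Chain rule for the coefficients: this is the only term in which the two frame expansions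
  -- differ.
  have h2 : mvfderiv 𝓘(ℝ, E₁) (frameCoeff F p i fun q ↦ Z (F q)) p u
      = mvfderiv 𝓘(ℝ, E₂) (c i) (F p) (push F p u) :=
    mvfderiv_comp_apply p (hc i) (mdifferentiableAt_map F p) u
  rw [h2]
  rfl

/-! ### Globally smooth fields with prescribed local behaviour -/

/-- The Kenmotsu identity is assumed for globally smooth fields only, so local frames are multiplied
by a bump function equal to 1 near x and with topological support in U. -/
theorem exists_contMDiff_extension [T2Space M] {Z : Π x : M, TangentSpace 𝓘(ℝ, E₂) x}
    {U : Set M} (hU : IsOpen U) (hZ : CMDiff[U] ∞ (T% Z)) {x : M} (hx : x ∈ U) :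
    ∃ Z' : Π x : M, TangentSpace 𝓘(ℝ, E₂) x, CMDiff ∞ (T% Z') ∧ ∀ᶠ y in 𝓝 x, Z' y = Z y := by
  obtain ⟨f, hf, -⟩ := (SmoothBumpFunction.nhds_basis_support (I := 𝓘(ℝ, E₂))
    (hU.mem_nhds hx)).mem_iff.mp (hU.mem_nhds hx)
  refine ⟨(f : M → ℝ) • Z, ContMDiffOn.smul_section_of_tsupport f.contMDiff.contMDiffOn hU hf hZ, ?_⟩
  filter_upwards [f.eventuallyEq_one] with y hy
  simp [hy]

theorem exists_contMDiff_coordFrame [T2Space M] (x : M) (i : Fin (Module.finrank ℝ E₂)) :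
    ∃ Z : Π x : M, TangentSpace 𝓘(ℝ, E₂) x, CMDiff ∞ (T% Z) ∧
      ∀ᶠ y in 𝓝 x, Z y = coordFrame x i y :=
  exists_contMDiff_extension (Trivialization.open_baseSet _)
    (contMDiffOn_localFrame_baseSet _ _ _ _) (mem_baseSet_trivializationAt E₂ _ x)

theorem exists_contMDiff_apply_eq [T2Space M] (x : M) (v : TangentSpace 𝓘(ℝ, E₂) x) :
    ∃ Z : Π x : M, TangentSpace 𝓘(ℝ, E₂) x, CMDiff ∞ (T% Z) ∧ Z x = v := by
  set e := trivializationAt E₂ (fun x : M ↦ TangentSpace 𝓘(ℝ, E₂) x) x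
  have hmem := mem_baseSet_trivializationAt E₂ (fun x : M ↦ TangentSpace 𝓘(ℝ, E₂) x) x
  let w : E₂ := (e ⟨x, v⟩).2
  -- The local field to extend is the one that is constant, equal to w, in the trivialization.
  obtain ⟨Z, hZ, hZx⟩ := exists_contMDiff_extension (Z := fun y ↦ e.symm y w) e.open_baseSet
    (by
      rw [e.contMDiffOn_section_baseSet_iff]
      refine (contMDiffOn_const (c := w)).congr fun y hy ↦ ?_
      simp [e.apply_mk_symm hy]) hmem
  refine ⟨Z, hZ, ?_⟩
  rw [hZx.self_of_nhds]
  exact e.symm_apply_apply_mk hmem v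

/-! ### The tensor ψ and the Kenmotsu identity along F -/

theorem contMDiff_kenmotsu_ψ (K : KenmotsuStructure E₂ M)
    {Z : Π x : M, TangentSpace 𝓘(ℝ, E₂) x} (hZ : CMDiff ∞ (T% Z)) :
    CMDiff ∞ (T% (fun x ↦ K.ψ x (Z x))) :=
  ContMDiff.clm_bundle_apply (b := fun x : M ↦ x) K.smooth_ψ hZ

theorem MDiffAlongAt.ψ {V : Π p : N, TangentSpace 𝓘(ℝ, E₂) (F p)} (K : KenmotsuStructure E₂ M)
    (hV : MDiffAlongAt F V p) : MDiffAlongAt F (fun q ↦ K.ψ (F q) (V q)) p := by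
  have h : MDifferentiableAt 𝓘(ℝ, E₂) (𝓘(ℝ, E₂).prod 𝓘(ℝ, E₂ →L[ℝ] E₂))
    (fun x ↦ TotalSpace.mk' (E₂ →L[ℝ] E₂)
      (E := fun x : M ↦ TangentSpace 𝓘(ℝ, E₂) x →L[ℝ] TangentSpace 𝓘(ℝ, E₂) x) x (K.ψ x)) (F p) :=
    K.smooth_ψ.contMDiffAt.mdifferentiableAt (by simp)
  exact MDifferentiableAt.clm_bundle_apply (b := F) (h.comp p (mdifferentiableAt_map F p)) hV

/-- The Kenmotsu identity for `∇ψ`, along a map. -/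
theorem pullbackConn_ψ [T2Space M] (K : KenmotsuStructure E₂ M)
    {V : Π p : N, TangentSpace 𝓘(ℝ, E₂) (F p)} (hV : MDiffAlongAt F V p)
    (u : TangentSpace 𝓘(ℝ, E₁) p) :
    pullbackConn F (fun q ↦ K.ψ (F q) (V q)) p u
      = K.ψ (F p) (pullbackConn F V p u)
        + (⟪K.ψ (F p) (push F p u), V p⟫_ℝ • K.ξ (F p)
          - K.η (F p) (V p) • K.ψ (F p) (push F p u)) := by
  -- Global fields Z i replace the coordinate frame near F p, and X realizes the direction F_*u.
  choose Z hZ hZe using exists_contMDiff_coordFrame (E₂ := E₂) (F p)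
  obtain ⟨X, hX, hXp⟩ := exists_contMDiff_apply_eq (F p) (push F p u)
  have hZd : ∀ i, MDiffAt (T% (Z i)) (F p) := fun i ↦ (hZ i).mdifferentiableAt (by simp)
  have hψZ := fun i ↦ contMDiff_kenmotsu_ψ K (hZ i)
  have hψZd : ∀ i, MDiffAt (T% (fun x ↦ K.ψ x (Z i x))) (F p) :=
    fun i ↦ (hψZ i).mdifferentiableAt (by simp)
  have hc := mdiffAlongAt_iff_frameCoeff.mp hV
  have hVe : ∀ᶠ q in 𝓝 p, V q = ∑ i, frameCoeff F p i V q • Z i (F q) := by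
    filter_upwards [eventually_mem_baseSet F p,
      (mdifferentiableAt_map F p).continuousAt.eventually (Filter.eventually_all.mpr hZe)]
      with q hq hq'
    simp only [hq']
    exact sum_frameCoeff_smul hq
  have hψVe : ∀ᶠ q in 𝓝 p, K.ψ (F q) (V q)
      = ∑ i, frameCoeff F p i V q • K.ψ (F q) (Z i (F q)) := by
    filter_upwards [hVe] with q hq
    conv_lhs => rw [hq]
    simp
  rw [pullbackConn_congr hψVe, pullbackConn_congr hVe,
    pullbackConn_sum fun i _ ↦ (mdiffAlongAt_comp (hψZd i)).smul (hc i),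
    pullbackConn_sum fun i _ ↦ (mdiffAlongAt_comp (hZd i)).smul (hc i)]
  conv_rhs => enter [2]; rw [hVe.self_of_nhds]
  simp only [map_sum, map_smul, inner_sum, Finset.sum_smul, ← Finset.sum_sub_distrib,
    ← Finset.sum_add_distrib, real_inner_smul_right]
  refine Finset.sum_congr rfl fun i _ ↦ ?_
  -- The derivatives of the coefficients enter both sides through the same term ψ(Z i). What remains
  -- is the identity on M for X and Z i, multiplied by the coefficient at p.
  rw [pullbackConn_smul (hc i) (mdiffAlongAt_comp (hψZd i)),
    pullbackConn_smul (hc i) (mdiffAlongAt_comp (hZd i)),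
    pullbackConn_comp (hψZd i), pullbackConn_comp (hZd i)]
  have h := K.nabla_ψ X (Z i) hX (hZ i) (F p)
  rw [hXp, sub_eq_iff_eq_add] at h
  rw [h]
  simp only [map_add, map_smul, smul_eq_mul]
  module

/-! ### Differentiability of F_*Y and of projections onto distributions -/

theorem mdiffAlongAt_push {Y : Π p : N, TangentSpace 𝓘(ℝ, E₁) p} (hY : CMDiff ∞ (T% Y)) :
    MDiffAlongAt F (fun q ↦ push F q (Y q)) p := by
  have h : ContMDiff 𝓘(ℝ, E₁).tangent 𝓘(ℝ, E₂).tangent 1 (tangentMap 𝓘(ℝ, E₁) 𝓘(ℝ, E₂) F) :=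
    F.contMDiff.contMDiff_tangentMap (WithTop.coe_le_coe.mpr le_top)
  exact (h.mdifferentiable (by simp) _).comp p (hY.mdifferentiableAt (by simp) : MDiffAt (T% Y) p)

/-- Projection onto a line field. -/
theorem MDiffAlongAt.starProjection_singleton {V W : Π p : N, TangentSpace 𝓘(ℝ, E₂) (F p)}
    (hV : MDiffAlongAt F V p) (hW : MDiffAlongAt F W p) (hp : V p ≠ 0) :
    MDiffAlongAt F (fun q ↦ (ℝ ∙ V q).starProjection (W q)) p := by
  simp only [Submodule.starProjection_singleton, ← real_inner_self_eq_norm_sq]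
  refine hV.smul ((hV.inner hW).div (hV.inner hV) ?_)
  simpa using hp

/-- Each step subtracts projections onto earlier lines, and these are differentiable where the
spanning vector is nonzero. Independence at the single point p suffices. -/
theorem MDiffAlongAt.gramSchmidt {r : ℕ} {s : Fin r → Π p : N, TangentSpace 𝓘(ℝ, E₂) (F p)}
    (hs : ∀ i, MDiffAlongAt F (s i) p) (hp : LinearIndependent ℝ fun i ↦ s i p) (i : Fin r) :
    MDiffAlongAt F (fun q ↦ InnerProductSpace.gramSchmidt ℝ (fun i ↦ s i q) i) p := by
  induction i using WellFoundedLT.induction with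
  | _ i ih =>
    have h : ∀ q, InnerProductSpace.gramSchmidt ℝ (fun i ↦ s i q) i = s i q - ∑ j ∈ Finset.Iio i,
        (ℝ ∙ InnerProductSpace.gramSchmidt ℝ (fun i ↦ s i q) j).starProjection (s i q) :=
      fun q ↦ InnerProductSpace.gramSchmidt_def _ _ _
    simp only [h]
    exact (hs i).sub (.sum fun j hj ↦ (ih j (Finset.mem_Iio.mp hj)).starProjection_singleton (hs i)
      (InnerProductSpace.gramSchmidt_ne_zero j hp))

/-- Reduces projection onto a distribution to projections onto lines. The g i need not be
normalized, and may even vanish. -/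
theorem starProjection_eq_sum_of_orthogonal {H : Type*} [NormedAddCommGroup H]
    [InnerProductSpace ℝ H] {ι : Type*} [Fintype ι] {g : ι → H}
    (hg : Pairwise fun i j ↦ ⟪g i, g j⟫_ℝ = 0) {D : Submodule ℝ H} [D.HasOrthogonalProjection]
    (hD : Submodule.span ℝ (Set.range g) = D) (v : H) :
    D.starProjection v = ∑ i, (ℝ ∙ g i).starProjection v := by
  have hmem : ∀ i, g i ∈ D := fun i ↦ hD ▸ Submodule.subset_span ⟨i, rfl⟩
  refine Submodule.eq_starProjection_of_mem_of_inner_eq_zero (sum_mem fun i _ ↦ ?_) fun w hw ↦ ?_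
  · rw [Submodule.starProjection_singleton]
    exact D.smul_mem _ (hmem i)
  · rw [← hD] at hw
    induction hw using Submodule.span_induction with
    | zero => simp
    | add x y _ _ hx hy => rw [inner_add_right, hx, hy, add_zero]
    | smul a x _ hx => rw [inner_smul_right, hx, mul_zero]
    | mem x hx =>
      obtain ⟨j, rfl⟩ := hx
      rw [inner_sub_left, sum_inner, Finset.sum_eq_single j, ← inner_sub_left]
      · exact Submodule.starProjection_inner_eq_zero _ _ (Submodule.mem_span_singleton_self _)
      · intro i _ hij
        rw [Submodule.starProjection_singleton, inner_smul_left, hg hij, mul_zero]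
      · simp

/-- Projection onto a smooth distribution along `F` preserves differentiability. -/
theorem IsSmoothDistribution.mdiffAlongAt_starProjection
    {D : Π p : N, Submodule ℝ (TangentSpace 𝓘(ℝ, E₂) (F p))} (hD : IsSmoothDistribution F D)
    {V : Π p : N, TangentSpace 𝓘(ℝ, E₂) (F p)} (hV : MDiffAlongAt F V p) :
    MDiffAlongAt F (fun q ↦ (D q).starProjection (V q)) p := by
  obtain ⟨U, hU, r, s, hs, hsD⟩ := hD p
  have hsd : ∀ i, MDiffAlongAt F (s i) p := fun i ↦
    ((hs i).contMDiffAt hU).mdifferentiableAt (by simp)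
  have hLI := (hsD p (mem_of_mem_nhds hU)).1
  refine MDiffAlongAt.congr (.sum (s := Finset.univ) fun i _ ↦
    (MDiffAlongAt.gramSchmidt hsd hLI i).starProjection_singleton hV
      (InnerProductSpace.gramSchmidt_ne_zero i hLI)) ?_
  filter_upwards [hU] with q hq
  refine starProjection_eq_sum_of_orthogonal
    (InnerProductSpace.gramSchmidt_pairwise_orthogonal ℝ _) ?_ _
  rw [InnerProductSpace.span_gramSchmidt, (hsD q hq).2]

theorem starProjection_sup_sup_singleton {H : Type*} [NormedAddCommGroup H]
    [InnerProductSpace ℝ H] [FiniteDimensional ℝ H] {R D₁ D₂ : Submodule ℝ H} {x : H}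
    (hR : R = D₁ ⊔ D₂ ⊔ ℝ ∙ x) (h₁₂ : D₁ ⟂ D₂) (h₁ : D₁ ⟂ ℝ ∙ x) (h₂ : D₂ ⟂ ℝ ∙ x) (v : H) :
    R.starProjection v
      = D₁.starProjection v + D₂.starProjection v + (ℝ ∙ x).starProjection v := by
  have hm₁ := D₁.starProjection_apply_mem v
  have hm₂ := D₂.starProjection_apply_mem v
  have hm₃ := (ℝ ∙ x).starProjection_apply_mem v
  have ho₁ := D₁.starProjection_inner_eq_zero v
  have ho₂ := D₂.starProjection_inner_eq_zero v
  have ho₃ := (ℝ ∙ x).starProjection_inner_eq_zero v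
  rw [Submodule.isOrtho_iff_inner_eq] at h₁₂ h₁ h₂
  subst hR
  refine Submodule.eq_starProjection_of_mem_of_inner_eq_zero
    (Submodule.add_mem_sup (Submodule.add_mem_sup hm₁ hm₂) hm₃) fun w hw ↦ ?_
  obtain ⟨w', hw', c, hc, rfl⟩ := Submodule.mem_sup.mp hw
  obtain ⟨a, ha, b, hb, rfl⟩ := Submodule.mem_sup.mp hw'
  have e₁ := ho₁ a ha
  have e₂ := ho₂ b hb
  have e₃ := ho₃ c hc
  have f₁ := h₁₂ _ hm₁ _ hb
  have f₂ := h₁ _ hm₁ _ hc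
  have f₃ := h₁₂ _ ha _ hm₂
  have f₄ := h₂ _ hm₂ _ hc
  have f₅ := h₁ _ ha _ hm₃
  have f₆ := h₂ _ hb _ hm₃
  rw [real_inner_comm] at f₃ f₅ f₆
  simp only [inner_add_right, inner_sub_left, inner_add_left] at *
  linarith

/-- If `ξ` is tangent to `range F_*`, the projection onto `range F_*` of a bi-slant Riemannian map
preserves differentiability. -/
theorem MDiffAlongAt.tanPart {K : KenmotsuStructure E₂ M} (hF : IsBiSlantRiemannianMap K F)
    (hξ : ∀ p, K.ξ (F p) ∈ ran F p) {V : Π p : N, TangentSpace 𝓘(ℝ, E₂) (F p)}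
    (hV : MDiffAlongAt F V p) : MDiffAlongAt F (fun q ↦ tanPart F q (V q)) p := by
  obtain ⟨-, D₁, D₂, θ₁, θ₂, hD₁, hD₂, -, -, h₁₂, -, h⟩ := hF
  have hξ0 : ∀ p, K.ξ (F p) ≠ 0 := fun p h0 ↦ by simpa [h0] using K.η_ξ (F p)
  -- The alternative with ξ normal is impossible: ξ would be orthogonal to itself, while η(ξ) = 1.
  have h' : ∀ p, K.ξ (F p) ∈ ran F p ∧ D₁ p ⟂ ℝ ∙ K.ξ (F p) ∧ D₂ p ⟂ ℝ ∙ K.ξ (F p) ∧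
      ran F p = D₁ p ⊔ D₂ p ⊔ ℝ ∙ K.ξ (F p) := h.resolve_right fun h ↦
    hξ0 p (inner_self_eq_zero (𝕜 := ℝ).mp ((Submodule.mem_orthogonal _ _).mp (h p).1 _ (hξ p)))
  have hξd : MDiffAlongAt F (fun q ↦ K.ξ (F q)) p :=
    mdiffAlongAt_comp (K.smooth_ξ.mdifferentiableAt (by simp))
  have e : (fun q ↦ RiemMap.tanPart F q (V q)) = fun q ↦ (D₁ q).starProjection (V q)
      + (D₂ q).starProjection (V q) + (ℝ ∙ K.ξ (F q)).starProjection (V q) :=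
    funext fun q ↦ starProjection_sup_sup_singleton (h' q).2.2.2 (h₁₂ q) (h' q).2.1 (h' q).2.2.1 _
  rw [e]
  exact ((hD₁.mdiffAlongAt_starProjection hV).add (hD₂.mdiffAlongAt_starProjection hV)).add
    (hξd.starProjection_singleton hV (hξ0 p))

/-! ### Pointwise algebra of range F_* and the adjoint -/

theorem tanPart_add_norPart (v : TangentSpace 𝓘(ℝ, E₂) (F p)) :
    tanPart F p v + norPart F p v = v := by
  simp [tanPart, norPart]

theorem norPart_add (v w : TangentSpace 𝓘(ℝ, E₂) (F p)) :
    norPart F p (v + w) = norPart F p v + norPart F p w := map_add _ _ _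

theorem norPart_sub (v w : TangentSpace 𝓘(ℝ, E₂) (F p)) :
    norPart F p (v - w) = norPart F p v - norPart F p w := map_sub _ _ _

theorem norPart_neg (v : TangentSpace 𝓘(ℝ, E₂) (F p)) :
    norPart F p (-v) = -norPart F p v := map_neg _ _

theorem norPart_smul (a : ℝ) (v : TangentSpace 𝓘(ℝ, E₂) (F p)) :
    norPart F p (a • v) = a • norPart F p v := map_smul _ _ _

theorem norPart_eq_zero_iff {v : TangentSpace 𝓘(ℝ, E₂) (F p)} :
    norPart F p v = 0 ↔ v ∈ ran F p := by
  rw [norPart, Submodule.starProjection_orthogonal_val, sub_eq_zero, eq_comm,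
    Submodule.starProjection_eq_self_iff]

/-- For a Riemannian map, `F_* ∘ *F_*` is the identity on `range F_*`. -/
theorem IsRiemannianMap.push_adj (hF : IsRiemannianMap F) {v : TangentSpace 𝓘(ℝ, E₂) (F p)}
    (hv : v ∈ ran F p) : push F p (adj F p v) = v := by
  obtain ⟨w, rfl⟩ := hv
  obtain ⟨k, hk, u, hu, rfl⟩ := (LinearMap.ker (push F p)).exists_add_mem_mem_orthogonal w
  have hk0 : push F p k = 0 := hk
  rw [map_add, hk0, zero_add]
  congr 1
  -- It remains to see that *F_*F_*u = u for horizontal u. Test against z = k' + u': F_* kills k',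
  -- and u is orthogonal to k'.
  refine ext_inner_right ℝ fun z ↦ ?_
  obtain ⟨k', hk', u', hu', rfl⟩ := (LinearMap.ker (push F p)).exists_add_mem_mem_orthogonal z
  have hk0' : push F p k' = 0 := hk'
  rw [adj, LinearMap.adjoint_inner_left, map_add, hk0', zero_add, hF p u hu u' hu',
    inner_add_right, (Submodule.mem_orthogonal' _ _).mp hu k' hk', zero_add]

/-! ### The normal component of ∇^F_X F_*Y and the theorem -/

/-- The normal component of `∇^F_X F_*Y` for a bi-slant Riemannian map with `ξ` tangent to
`range F_*`. -/
theorem norPart_pullbackConn_push [T2Space M] {K : KenmotsuStructure E₂ M}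
    (hF : IsBiSlantRiemannianMap K F) (hξ : ∀ p, K.ξ (F p) ∈ ran F p)
    (X : Π p : N, TangentSpace 𝓘(ℝ, E₁) p) {Y : Π p : N, TangentSpace 𝓘(ℝ, E₁) p}
    (hY : CMDiff ∞ (T% Y)) (p : N) :
    norPart F p (pullbackConn F (fun q ↦ push F q (Y q)) p (X p))
      = opQ K F p
          (shape F (fun q ↦ opQ K F q (push F q (Y q))) X p
            - push F p (leviCivita E₁ N
                (fun q ↦ adj F q (opP K F q (push F q (Y q)))) p (X p)))
        - opω K F p
          (secondFF F X (fun q ↦ adj F q (opP K F q (push F q (Y q)))) p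
            + normalConn F (fun q ↦ opQ K F q (push F q (Y q))) X p) := by
  set W : Π p : N, TangentSpace 𝓘(ℝ, E₂) (F p) := fun q ↦ push F q (Y q)
  have hW : MDiffAlongAt F W p := mdiffAlongAt_push hY
  have hψW := hW.ψ K
  have hP : MDiffAlongAt F (fun q ↦ opP K F q (W q)) p := hψW.tanPart hF hξ
  have hPQ : ∀ q, K.ψ (F q) (W q) = opP K F q (W q) + opQ K F q (W q) :=
    fun q ↦ (tanPart_add_norPart _).symm
  -- QW is differentiable as the difference ψW - PW.
  have hQ : MDiffAlongAt F (fun q ↦ opQ K F q (W q)) p :=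
    (hψW.sub hP).congr (.of_forall fun q ↦ by rw [hPQ]; abel)
  have hpush : (fun q ↦ push F q (adj F q (opP K F q (W q)))) = fun q ↦ opP K F q (W q) :=
    funext fun q ↦ hF.1.push_adj (Submodule.starProjection_apply_mem _ _)
  have key := pullbackConn_ψ K hW (X p)
  rw [pullbackConn_congr (.of_forall hPQ), pullbackConn_add hP hQ] at key
  -- Applying ψ again recovers -∇^F_X W modulo ξ and F_*X, which have no normal part.
  have hψ2 := congrArg (fun v ↦ norPart F p (K.ψ (F p) v)) key
  have hξ0 : norPart F p (K.ξ (F p)) = 0 := norPart_eq_zero_iff.mpr (hξ p)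
  have hX0 : norPart F p (push F p (X p)) = 0 := norPart_eq_zero_iff.mpr ⟨_, rfl⟩
  have hN : norPart F p (pullbackConn F W p (X p))
      = -norPart F p (K.ψ (F p) (pullbackConn F (fun q ↦ opP K F q (W q)) p (X p)
        + pullbackConn F (fun q ↦ opQ K F q (W q)) p (X p))) := by
    rw [hψ2]
    simp [K.ψ_ψ, K.ψ_ξ, norPart_add, norPart_neg, norPart_smul, hξ0, hX0]
  -- Both `opQ` and `opω` are v ↦ (ψv)^⊥ on the whole tangent space, so their arguments combine by
  -- linearity. The term F_*(∇_X *F_*PW) then cancels against the one inside `secondFF`; neither its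
  -- differentiability nor the normality of `secondFF` is needed.
  rw [hN, opQ, opω, ← norPart_sub, ← map_sub, ← norPart_neg, ← map_neg, secondFF, hpush]
  congr 2
  nth_rw 1 [← tanPart_add_norPart (pullbackConn F (fun q ↦ opQ K F q (W q)) p (X p))]
  rw [shape, normalConn]
  abel

end RiemMap

end

theorem theorem3p1
    {E₁ : Type*} [NormedAddCommGroup E₁] [NormedSpace ℝ E₁] [FiniteDimensional ℝ E₁]
    {N : Type*} [TopologicalSpace N] [T2Space N] [ChartedSpace E₁ N] [IsManifold 𝓘(ℝ, E₁) ∞ N]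
    [RiemannianBundle (fun p : N ↦ TangentSpace 𝓘(ℝ, E₁) p)]
    [IsContMDiffRiemannianBundle 𝓘(ℝ, E₁) ∞ E₁ (fun p : N ↦ TangentSpace 𝓘(ℝ, E₁) p)]
    {E₂ : Type*} [NormedAddCommGroup E₂] [NormedSpace ℝ E₂] [FiniteDimensional ℝ E₂]
    {M : Type*} [TopologicalSpace M] [T2Space M] [ChartedSpace E₂ M] [IsManifold 𝓘(ℝ, E₂) ∞ M]
    [RiemannianBundle (fun x : M ↦ TangentSpace 𝓘(ℝ, E₂) x)]
    [IsContMDiffRiemannianBundle 𝓘(ℝ, E₂) ∞ E₂ (fun x : M ↦ TangentSpace 𝓘(ℝ, E₂) x)]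
    (K : KenmotsuStructure E₂ M) (F : C^∞⟮𝓘(ℝ, E₁), N; 𝓘(ℝ, E₂), M⟯)
    (hF : IsBiSlantRiemannianMap K F) (hξ : ∀ p, K.ξ (F p) ∈ ran F p) :
    RangeTotallyGeodesic F ↔
      ∀ X Y : Π p : N, TangentSpace 𝓘(ℝ, E₁) p, IsHorizontalField F X → IsHorizontalField F Y →
        ∀ p : N,
          opQ K F p
            (shape F (fun q ↦ opQ K F q (push F q (Y q))) X p
              - push F p (leviCivita E₁ N
                  (fun q ↦ adj F q (opP K F q (push F q (Y q)))) p (X p)))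
          = opω K F p
            (secondFF F X (fun q ↦ adj F q (opP K F q (push F q (Y q)))) p
              + normalConn F (fun q ↦ opQ K F q (push F q (Y q))) X p) := by
  have key := fun (X Y : Π p : N, TangentSpace 𝓘(ℝ, E₁) p) (hY : IsHorizontalField F Y) (p : N) ↦
    norPart_pullbackConn_push hF hξ X hY.1 p
  refine forall₄_congr fun X Y _ hY ↦ forall_congr' fun p ↦ ?_
  rw [← norPart_eq_zero_iff, key X Y hY p, sub_eq_zero]
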